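/- Let $A$ and $B$ be complex $n\times n$ matrices with $B$ positive semidefinite, let $q\ge 1$ be a real number, and let $|||\cdot|||$ be a unitarily invariant norm on the complex $n\times n$ matrices, that is, a norm with $|||UXV|||=|||X|||$ for every matrix $X$ and all unitary matrices $U,V$. Then $$|||(ABA^*)^q|||\le |||\,|A|^q B^q |A|^q\,|||,$$ where $A^*$ is the conjugate transpose of $A$, $|A|=(A^*A)^{1/2}$ is its modulus, and real powers of positive semidefinite matrices are taken in the sense of functional calculus. -/

import Mathlib

open scoped Matrix MatrixOrder ComplexOrder

/-- A seminorm `N` on the space of complex square matrices is a *unitarily invariant norm* if it is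
a norm (that is, it vanishes at the zero matrix only) and `N (U * X * V) = N X` for every matrix `X`
and all unitary matrices `U` and `V`. -/
structure IsUnitarilyInvariantNorm {n : Type*} [Fintype n] [DecidableEq n]
    (N : Seminorm ℂ (Matrix n n ℂ)) : Prop where
  eq_zero_of_map_eq_zero : ∀ X : Matrix n n ℂ, N X = 0 → X = 0
  map_unitary_mul_mul : ∀ U ∈ Matrix.unitaryGroup n ℂ, ∀ V ∈ Matrix.unitaryGroup n ℂ,
    ∀ X : Matrix n n ℂ, N (U * X * V) = N X

/-! ### Operator norm inequality in a C⋆-algebra. -/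

namespace CFC

open scoped NNReal

variable {A : Type*} [CStarAlgebra A] [PartialOrder A] [StarOrderedRing A]

/-! For the operator norm the claim follows from Löwner–Heinz: `norm_mul_mul_rpow_le`, with `a`
replaced by its modulus through `norm_mul_mul_star_eq_of_mul_self_eq`. The `k`-th compound is
multiplicative and commutes with adjoints and with powers of positive semidefinite matrices, so the
same bound holds for all compounds of the two sides. The norm of the compound of a positive
semidefinite matrix is the largest product of `k` of its eigenvalues; hence the eigenvalues `x` of
the left side are weakly log-majorized by those, `y`, of the right side. This puts `x` in the convex
hull of the signed permutations of `y` (`mem_convexHull_signed_perm_of_prod_le`). A unitarily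
invariant norm is convex and constant on the corresponding diagonal matrices, which gives the
inequality. -/

theorem smul_rpow_eq_cfc {a : A} (ha : IsStrictlyPositive a) (r : ℝ≥0) (p : ℝ) :
    (r • a ^ p) = cfc (fun x : ℝ≥0 => r * x ^ p) a := by
  have h0 : (0 : ℝ≥0) ∉ spectrum ℝ≥0 a := spectrum.zero_notMem _ ha.isUnit
  have hc : ContinuousOn (fun x : ℝ≥0 => x ^ p) (spectrum ℝ≥0 a) :=
    NNReal.continuousOn_rpow_const (.inl h0)
  rw [cfc_const_mul r (fun x : ℝ≥0 => x ^ p) a hc, rpow_def]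

theorem smul_rpow_rpow {a : A} (ha : IsStrictlyPositive a) (r : ℝ≥0) (p s : ℝ) (hs : 0 ≤ s) :
    (r • a ^ p) ^ s = r ^ s • a ^ (p * s) := by
  have h0 : (0 : ℝ≥0) ∉ spectrum ℝ≥0 a := spectrum.zero_notMem _ ha.isUnit
  have hc : ContinuousOn (fun x : ℝ≥0 => x ^ p) (spectrum ℝ≥0 a) :=
    NNReal.continuousOn_rpow_const (.inl h0)
  have hc2 : ContinuousOn (fun x : ℝ≥0 => r * x ^ p) (spectrum ℝ≥0 a) :=
    continuousOn_const.mul hc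
  rw [smul_rpow_eq_cfc ha, smul_rpow_eq_cfc ha, rpow_def,
    ← cfc_comp' (fun x : ℝ≥0 => x ^ s) _ a
      ((NNReal.continuousOn_rpow_const (.inr hs)).mono (Set.subset_univ _)) hc2]
  refine cfc_congr fun x _ => ?_
  simp [NNReal.mul_rpow, NNReal.rpow_mul]

/-- If `M` is the right-hand norm, conjugation by `a ^ (-q)` gives `b ^ q ≤ M • a ^ (-2q)`. The
power `q⁻¹ ≤ 1` is operator monotone, so `b ≤ M ^ q⁻¹ • a ^ (-2)`; then conjugate by `a`. -/
theorem norm_mul_mul_rpow_le_of_isStrictlyPositive {a b : A} (ha : IsStrictlyPositive a)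
    (hb : 0 ≤ b) {q : ℝ} (hq : 1 ≤ q) : ‖a * b * a‖ ^ q ≤ ‖a ^ q * b ^ q * a ^ q‖ := by
  have hq0 : 0 < q := by linarith
  set M : ℝ≥0 := ‖a ^ q * b ^ q * a ^ q‖₊ with hM
  have hsa (p : ℝ) : IsSelfAdjoint (a ^ p) := .of_nonneg rpow_nonneg
  have hbq : 0 ≤ a ^ q * b ^ q * a ^ q := (hsa q).conjugate_nonneg rpow_nonneg
  have h1 : a ^ q * b ^ q * a ^ q ≤ algebraMap ℝ A M :=
    (IsSelfAdjoint.of_nonneg hbq).le_algebraMap_norm_self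
  have h2 : b ^ q ≤ M • a ^ (-(2 * q)) := by
    have h := (hsa (-q)).conjugate_le_conjugate h1
    have e1 : a ^ (-q) * (a ^ q * b ^ q * a ^ q) * a ^ (-q) = b ^ q := by
      calc _ = (a ^ (-q) * a ^ q) * b ^ q * (a ^ q * a ^ (-q)) := by simp only [mul_assoc]
        _ = _ := by rw [rpow_neg_mul_rpow q ha, rpow_mul_rpow_neg q ha, one_mul, mul_one]
    have e2 : a ^ (-q) * algebraMap ℝ A M * a ^ (-q) = M • a ^ (-(2 * q)) := by
      rw [← Algebra.commutes, mul_assoc, ← rpow_add ha.isUnit, ← Algebra.smul_def, NNReal.smul_def]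
      congr 2; ring
    rwa [e1, e2] at h
  have h3 : b ≤ M ^ q⁻¹ • a ^ (-2 : ℝ) := by
    have h := rpow_le_rpow (p := q⁻¹) ⟨by positivity, inv_le_one_of_one_le₀ hq⟩ h2
    rwa [smul_rpow_rpow ha _ _ _ (by positivity),
      rpow_rpow_of_exponent_nonneg b q q⁻¹ hq0.le (by positivity) hb,
      mul_inv_cancel₀ hq0.ne', rpow_one b hb,
      show -(2 * q) * q⁻¹ = -2 by field_simp] at h
  have ha1 : IsSelfAdjoint a := .of_nonneg ha.nonneg
  have h4 : a * b * a ≤ algebraMap ℝ A ((M : ℝ) ^ q⁻¹) := by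
    have h := ha1.conjugate_le_conjugate h3
    have e : a * (M ^ q⁻¹ • a ^ (-2 : ℝ)) * a = algebraMap ℝ A ((M : ℝ) ^ q⁻¹) := by
      have : a * a ^ (-2 : ℝ) * a = 1 := by
        nth_rw 1 3 [← rpow_one a ha.nonneg]
        rw [← rpow_add ha.isUnit, ← rpow_add ha.isUnit]
        norm_num
        exact rpow_zero a ha.nonneg
      rw [mul_smul_comm, smul_mul_assoc, this, NNReal.smul_def, Algebra.algebraMap_eq_smul_one]
      simp
    rwa [e] at h
  have h5 : ‖a * b * a‖ ≤ (M : ℝ) ^ q⁻¹ :=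
    (CStarAlgebra.norm_le_iff_le_algebraMap _ (by positivity) (ha1.conjugate_nonneg hb)).2 h4
  calc ‖a * b * a‖ ^ q ≤ ((M : ℝ) ^ q⁻¹) ^ q := by gcongr
    _ = M := Real.rpow_inv_rpow M.2 hq0.ne'
    _ = _ := rfl

open Filter Topology in
theorem norm_mul_mul_rpow_le {a b : A} (ha : 0 ≤ a) (hb : 0 ≤ b) {q : ℝ} (hq : 1 ≤ q) :
    ‖a * b * a‖ ^ q ≤ ‖a ^ q * b ^ q * a ^ q‖ := by
  have hq0 : 0 < q := by linarith
  -- Perturb `a` to the invertible `a + t` and let `t → 0⁺`.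
  let f : ℝ → A := fun t => a + algebraMap ℝ A t
  have hf : Tendsto f (𝓝[>] 0) (𝓝 a) := by
    have : Continuous f := continuous_const.add (continuous_algebraMap ℝ A)
    simpa [f] using (this.tendsto 0).mono_left nhdsWithin_le_nhds
  have hpos : ∀ t > 0, IsStrictlyPositive (f t) := fun t ht =>
    IsStrictlyPositive.nonneg_add ha ((IsStrictlyPositive.iff_of_unital).2
      ⟨algebraMap_nonneg A ht.le, (isUnit_iff_ne_zero.2 ht.ne').map (algebraMap ℝ A)⟩)
  have hfq : Tendsto (fun t => f t ^ q) (𝓝[>] 0) (𝓝 (a ^ q)) := by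
    lift q to ℝ≥0 using hq0.le
    have hq' : 0 < q := by exact_mod_cast hq0
    have := (continuousOn_nnrpow (A := A) q a ha).tendsto.comp
      (tendsto_nhdsWithin_iff.2 ⟨hf, by
        filter_upwards [self_mem_nhdsWithin] with t ht using (hpos t ht).nonneg⟩)
    simpa [Function.comp_def, nnrpow_eq_rpow hq'] using this
  have h1 : Tendsto (fun t => ‖f t * b * f t‖ ^ q) (𝓝[>] 0) (𝓝 (‖a * b * a‖ ^ q)) :=
    ((hf.mul_const b).mul hf).norm.rpow_const (.inr hq0.le)
  have h2 := ((hfq.mul_const (b ^ q)).mul hfq).norm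
  refine le_of_tendsto_of_tendsto h1 h2 ?_
  filter_upwards [self_mem_nhdsWithin] with t ht
  exact norm_mul_mul_rpow_le_of_isStrictlyPositive (hpos t ht) hb hq

/-- By the C⋆-identity, `‖c * b * star c‖` depends on `c` only through `star c * c`. No polar
decomposition is needed. -/
theorem norm_mul_mul_star_eq_of_mul_self_eq {a b p : A} (hb : 0 ≤ b) (hp : IsSelfAdjoint p)
    (h : p * p = star a * a) : ‖a * b * star a‖ = ‖p * b * p‖ := by
  have hs : IsSelfAdjoint (sqrt b) := .of_nonneg (sqrt_nonneg b)
  have key (c : A) : ‖c * b * star c‖ = ‖sqrt b * (star c * c) * sqrt b‖ := by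
    have e1 : c * b * star c = (c * sqrt b) * star (c * sqrt b) := by
      rw [star_mul, hs.star_eq, mul_assoc c (sqrt b), ← mul_assoc (sqrt b), sqrt_mul_sqrt_self b hb,
        mul_assoc]
    have e2 : sqrt b * (star c * c) * sqrt b = star (c * sqrt b) * (c * sqrt b) := by
      rw [star_mul, hs.star_eq]; simp only [mul_assoc]
    rw [e1, e2, CStarRing.norm_self_mul_star, CStarRing.norm_star_mul_self]
  have := key p
  rw [hp.star_eq, h, ← key a] at this
  exact this.symm

end CFC

namespace Matrix

open scoped Matrix.Norms.L2Operator
open Set (powersetCard)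

/-! ### Unitary diagonalization and real powers. -/

section UnitaryDiagonal

variable {n : Type*} [Fintype n] [DecidableEq n]

/-- The algebra homomorphism `d ↦ U * diagonal d * Uᴴ` for a unitary matrix `U`. -/
noncomputable def unitaryDiagonal (U : unitaryGroup n ℂ) : (n → ℝ) →ₐ[ℝ] Matrix n n ℂ :=
  ((Unitary.conjStarAlgAut ℂ (Matrix n n ℂ) U :
    Matrix n n ℂ →⋆ₐ[ℂ] Matrix n n ℂ).toAlgHom.restrictScalars ℝ).comp ((diagonalAlgHom ℝ).comp (AlgHom.compLeft Complex.ofRealAm n))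

theorem unitaryDiagonal_apply (U : unitaryGroup n ℂ) (d : n → ℝ) :
    unitaryDiagonal U d = U * diagonal (fun i => (d i : ℂ)) * (U : Matrix n n ℂ)ᴴ := rfl

theorem PosSemidef.exists_eq_unitaryDiagonal {A : Matrix n n ℂ} (hA : A.PosSemidef) :
    ∃ (U : unitaryGroup n ℂ) (d : n → ℝ), 0 ≤ d ∧ A = unitaryDiagonal U d :=
  ⟨hA.isHermitian.eigenvectorUnitary, hA.isHermitian.eigenvalues, hA.eigenvalues_nonneg,
    hA.isHermitian.spectral_theorem⟩

theorem posSemidef_unitaryDiagonal (U : unitaryGroup n ℂ) {d : n → ℝ} (hd : 0 ≤ d) :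
    (unitaryDiagonal U d).PosSemidef := by
  rw [unitaryDiagonal_apply]
  refine PosSemidef.mul_mul_conjTranspose_same (posSemidef_diagonal_iff.2 fun i => ?_) _
  exact_mod_cast hd i

theorem norm_unitaryDiagonal (U : unitaryGroup n ℂ) (d : n → ℝ) : ‖unitaryDiagonal U d‖ = ‖d‖ := by
  have h := CStarRing.norm_mul_coe_unitary
    ((U : Matrix n n ℂ) * diagonal (fun i => (d i : ℂ))) (star U)
  rw [CStarRing.norm_coe_unitary_mul, l2_opNorm_diagonal] at h
  refine h.trans ?_
  simp [Pi.norm_def]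

theorem unitaryDiagonal_rpow (U : unitaryGroup n ℂ) {d : n → ℝ} (hd : 0 ≤ d) (q : ℝ) :
    unitaryDiagonal U d ^ q = unitaryDiagonal U (fun i => d i ^ q) := by
  have hA := nonneg_iff_posSemidef.2 (posSemidef_unitaryDiagonal U hd)
  let s := Finset.univ.image d
  -- On the finite spectrum the power is a polynomial, and polynomials commute with algebra
  -- homomorphisms.
  let p := Lagrange.interpolate s id (fun x : ℝ => x ^ q)
  have hp (i : n) : p.eval (d i) = d i ^ q :=
    Lagrange.eval_interpolate_at_node _ (Set.injOn_id _)
      (Finset.mem_image_of_mem d (Finset.mem_univ i))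
  rw [CFC.rpow_eq_cfc_real hA]
  have hcongr : (spectrum ℝ (unitaryDiagonal U d)).EqOn (fun x : ℝ => x ^ q) p.eval := by
    intro x hx
    have hx' := AlgHom.spectrum_apply_subset (unitaryDiagonal U) d hx
    rw [Pi.spectrum_eq] at hx'
    obtain ⟨i, hi⟩ := Set.mem_iUnion.1 hx'
    obtain rfl : x = d i := by
      by_contra hne
      exact spectrum.mem_iff.1 hi (isUnit_iff_ne_zero.2 (sub_ne_zero.2 hne))
    exact (hp i).symm
  rw [cfc_congr hcongr, cfc_polynomial p _ (IsSelfAdjoint.of_nonneg hA), Polynomial.aeval_algHom_apply]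
  congr 1
  ext i
  rw [← hp i]
  simp

end UnitaryDiagonal

/-! ### Compound matrices. -/

section Compound

variable {n : Type*} [Fintype n] [LinearOrder n] (k : ℕ)

/-- The `k`-th compound matrix, with entries the `k × k` minors. -/
noncomputable def compound (A : Matrix n n ℂ) : Matrix (powersetCard n k) (powersetCard n k) ℂ :=
  LinearMap.toMatrix ((Pi.basisFun ℂ n).exteriorPower k) ((Pi.basisFun ℂ n).exteriorPower k)
    (exteriorPower.map k (toLin' A))

theorem compound_apply (A : Matrix n n ℂ) (s t : powersetCard n k) :
    compound k A s t =
      (A.submatrix (Set.powersetCard.ofFinEmbEquiv.symm s)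
        (Set.powersetCard.ofFinEmbEquiv.symm t)).det := by
  rw [compound, LinearMap.toMatrix_apply, exteriorPower.basis_apply, exteriorPower.ιMulti_family,
    exteriorPower.map_apply_ιMulti, exteriorPower.basis_repr_apply,
    exteriorPower.ιMultiDual_apply_ιMulti, ← det_transpose]
  congr 1
  ext i j
  simp [Pi.basisFun_apply]

@[simp]
theorem compound_one : compound k (1 : Matrix n n ℂ) = 1 := by
  rw [compound, toLin'_one, exteriorPower.map_id, LinearMap.toMatrix_id]

theorem compound_mul (A B : Matrix n n ℂ) : compound k (A * B) = compound k A * compound k B := by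
  rw [compound, toLin'_mul, exteriorPower.map_comp, LinearMap.toMatrix_comp _
    ((Pi.basisFun ℂ n).exteriorPower k)]
  rfl

theorem compound_conjTranspose (A : Matrix n n ℂ) : compound k Aᴴ = (compound k A)ᴴ := by
  ext s t
  rw [conjTranspose_apply, compound_apply, compound_apply, ← conjTranspose_submatrix,
    det_conjTranspose]

theorem compound_diagonal (d : n → ℂ) :
    compound k (diagonal d) = diagonal fun s : powersetCard n k => ∏ i ∈ s.1, d i := by
  ext s t
  rw [compound_apply]
  obtain rfl | hst := eq_or_ne s t
  · rw [submatrix_diagonal _ _ (RelEmbedding.injective _), det_diagonal, diagonal_apply_eq,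
      ← s.1.map_orderEmbOfFin_univ s.2, Finset.prod_map]
    rfl
  · rw [diagonal_apply_ne _ hst]
    obtain ⟨i, his, hit⟩ := (Set.powersetCard.exists_mem_notMem_iff_ne s t).1 hst
    obtain ⟨a, rfl⟩ := (Set.powersetCard.mem_range_ofFinEmbEquiv_symm_iff_mem s i).2 his
    refine det_eq_zero_of_row_eq_zero a fun b => diagonal_apply_ne _ fun hab => hit ?_
    rw [hab]
    exact (Set.powersetCard.mem_range_ofFinEmbEquiv_symm_iff_mem t _).1 ⟨b, rfl⟩

theorem compound_mem_unitaryGroup {U : Matrix n n ℂ} (hU : U ∈ unitaryGroup n ℂ) :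
    compound k U ∈ unitaryGroup (powersetCard n k) ℂ := by
  rw [mem_unitaryGroup_iff, star_eq_conjTranspose, ← compound_conjTranspose, ← compound_mul,
    ← star_eq_conjTranspose, mem_unitaryGroup_iff.1 hU, compound_one]

/-- The compound matrix of a unitary matrix, as a unitary matrix. -/
noncomputable def compoundUnitary (U : unitaryGroup n ℂ) : unitaryGroup (powersetCard n k) ℂ :=
  ⟨compound k U.1, compound_mem_unitaryGroup (U := U.1) k U.2⟩

theorem compound_unitaryDiagonal (U : unitaryGroup n ℂ) (d : n → ℝ) :
    compound k (unitaryDiagonal U d) =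
      unitaryDiagonal (compoundUnitary k U) fun s : powersetCard n k => ∏ i ∈ s.1, d i := by
  rw [unitaryDiagonal_apply, unitaryDiagonal_apply, compound_mul, compound_mul,
    compound_conjTranspose, compound_diagonal]
  simp only [Complex.ofReal_prod]
  rfl

variable {k}

theorem PosSemidef.compound {A : Matrix n n ℂ} (hA : A.PosSemidef) : (compound k A).PosSemidef := by
  obtain ⟨U, d, hd, rfl⟩ := hA.exists_eq_unitaryDiagonal
  rw [compound_unitaryDiagonal]
  exact posSemidef_unitaryDiagonal _ fun s => Finset.prod_nonneg fun i _ => hd i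

theorem PosSemidef.compound_rpow {A : Matrix n n ℂ} (hA : A.PosSemidef) (q : ℝ) :
    Matrix.compound k (A ^ q) = Matrix.compound k A ^ q := by
  obtain ⟨U, d, hd, rfl⟩ := hA.exists_eq_unitaryDiagonal
  rw [unitaryDiagonal_rpow U hd, compound_unitaryDiagonal, compound_unitaryDiagonal,
    unitaryDiagonal_rpow _ (fun s => Finset.prod_nonneg fun i _ => hd i)]
  congr 1
  ext s
  exact (Real.finsetProd_rpow _ _ (fun i _ => hd i) q)

theorem norm_compound_mul_mul_conjTranspose_rpow_le (k : ℕ) (A : Matrix n n ℂ) {B : Matrix n n ℂ}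
    (hB : B.PosSemidef) {q : ℝ} (hq : 1 ≤ q) :
    ‖compound k ((A * B * Aᴴ) ^ q)‖ ≤ ‖compound k (CFC.abs A ^ q * B ^ q * CFC.abs A ^ q)‖ := by
  have hP : (CFC.abs A).PosSemidef := nonneg_iff_posSemidef.1 (CFC.abs_nonneg A)
  have hX : (A * B * Aᴴ).PosSemidef := hB.mul_mul_conjTranspose_same A
  have hPk := nonneg_iff_posSemidef.2 (hP.compound (k := k))
  have hBk := nonneg_iff_posSemidef.2 (hB.compound (k := k))
  have habs : compound k (CFC.abs A) * compound k (CFC.abs A)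
      = star (compound k A) * compound k A := by
    rw [star_eq_conjTranspose, ← compound_conjTranspose, ← compound_mul, ← compound_mul,
      CFC.abs_mul_abs, star_eq_conjTranspose]
  rw [hX.compound_rpow, CFC.norm_rpow _ (by linarith) (nonneg_iff_posSemidef.2 hX.compound)]
  simp only [compound_mul, compound_conjTranspose, hP.compound_rpow, hB.compound_rpow]
  rw [← star_eq_conjTranspose, CFC.norm_mul_mul_star_eq_of_mul_self_eq hBk (.of_nonneg hPk) habs]
  exact CFC.norm_mul_mul_rpow_le hPk hBk hq

theorem norm_compound_unitaryDiagonal (U : unitaryGroup n ℂ) (d : n → ℝ) :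
    ‖compound k (unitaryDiagonal U d)‖ = ‖fun s : powersetCard n k => ∏ i ∈ s.1, d i‖ := by
  rw [compound_unitaryDiagonal, norm_unitaryDiagonal]

end Compound

end Matrix

/-! ### Weak log-majorization of real vectors. -/

section Majorization

open Finset

/-- Abel summation, as an induction on partial sums. -/
theorem Antitone.sum_range_mul_nonneg {w d : ℕ → ℝ} (hw : Antitone w) (hw0 : ∀ i, 0 ≤ w i) {m : ℕ}
    (hd : ∀ k ≤ m, 0 ≤ ∑ i ∈ range k, d i) : 0 ≤ ∑ i ∈ range m, w i * d i := by
  have key : ∀ k ≤ m, w k * ∑ i ∈ range k, d i ≤ ∑ i ∈ range k, w i * d i := by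
    intro k
    induction k with
    | zero => simp
    | succ k ih =>
      intro hk
      have h1 := ih (by omega)
      have h2 := mul_le_mul_of_nonneg_right (hw (Nat.le_succ k)) (hd (k + 1) hk)
      rw [sum_range_succ] at h2 ⊢
      rw [sum_range_succ]
      linarith [mul_add (w k) (∑ i ∈ range k, d i) (d k)]
  exact (mul_nonneg (hw0 m) (hd m le_rfl)).trans (key m le_rfl)

/-- The bound `x * log (y / x) ≤ y - x` reduces the claim to Abel summation with the antitone
weights `a i * x i`. -/
theorem sum_range_mul_le_sum_range_mul_of_prod_range_le {a x y : ℕ → ℝ} (ha : Antitone a)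
    (ha0 : ∀ i, 0 ≤ a i) (hx : Antitone x) (hx0 : ∀ i, 0 ≤ x i) (hy0 : ∀ i, 0 ≤ y i) {m : ℕ}
    (h : ∀ k ≤ m, ∏ i ∈ range k, x i ≤ ∏ i ∈ range k, y i) :
    ∑ i ∈ range m, a i * x i ≤ ∑ i ∈ range m, a i * y i := by
  have hxpos : ∀ k, 0 < x k → ∀ i ∈ range (k + 1), 0 < x i := fun k hk i hi =>
    hk.trans_le (hx (by simpa [Nat.lt_succ_iff] using hi))
  have hypos : ∀ k < m, 0 < x k → ∀ i ∈ range (k + 1), 0 < y i := fun k hkm hk i hi =>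
    (hy0 i).lt_of_ne' (prod_ne_zero_iff.1 ((prod_pos (hxpos k hk)).trans_le (h (k + 1) hkm)).ne' i hi)
  -- Where `x` vanishes so does the weight, so `d` may be 0 there; as `x` is antitone, this happens
  -- only on a tail.
  let d : ℕ → ℝ := fun i => if 0 < x i then Real.log (y i) - Real.log (x i) else 0
  have hd : ∀ k ≤ m, 0 ≤ ∑ i ∈ range k, d i := by
    intro k
    induction k with
    | zero => simp
    | succ k ih =>
      intro hk
      by_cases hxk : 0 < x k
      · have e : ∑ i ∈ range (k + 1), d i
            = ∑ i ∈ range (k + 1), Real.log (y i) - ∑ i ∈ range (k + 1), Real.log (x i) := by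
          rw [← sum_sub_distrib]
          exact sum_congr rfl fun i hi => if_pos (hxpos k hxk i hi)
        rw [e, ← Real.log_prod fun i hi => (hypos k hk hxk i hi).ne',
          ← Real.log_prod fun i hi => (hxpos k hxk i hi).ne', sub_nonneg]
        exact Real.log_le_log (prod_pos (hxpos k hxk)) (h (k + 1) hk)
      · rw [sum_range_succ, show d k = 0 from if_neg hxk, add_zero]
        exact ih (by omega)
  have hw : Antitone fun i => a i * x i := fun i j hij =>
    mul_le_mul (ha hij) (hx hij) (hx0 j) (ha0 i)
  have hle : ∀ i ∈ range m, a i * x i * d i ≤ a i * y i - a i * x i := by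
    intro i hi
    by_cases hxi : 0 < x i
    · have hyi := hypos i (mem_range.1 hi) hxi i (by simp)
      have hlog := Real.log_le_sub_one_of_pos (div_pos hyi hxi)
      rw [Real.log_div hyi.ne' hxi.ne'] at hlog
      have h1 := mul_le_mul_of_nonneg_left hlog (mul_nonneg (ha0 i) hxi.le)
      have h2 : a i * x i * (y i / x i - 1) = a i * y i - a i * x i := by field_simp
      rw [h2] at h1
      simpa [d, hxi] using h1
    · have : x i = 0 := le_antisymm (not_lt.1 hxi) (hx0 i)
      simpa [this] using mul_nonneg (ha0 i) (hy0 i)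
  have h1 := (hw.sum_range_mul_nonneg (fun i => mul_nonneg (ha0 i) (hx0 i)) hd).trans
    (sum_le_sum hle)
  rw [sum_sub_distrib] at h1
  linarith

theorem Antitone.prod_le_prod_castLE {m k : ℕ} (hk : k ≤ m) {y : Fin m → ℝ} (hy : Antitone y)
    (hy0 : ∀ i, 0 ≤ y i) {T : Finset (Fin m)} (hT : #T = k) :
    ∏ i ∈ T, y i ≤ ∏ i : Fin k, y (Fin.castLE hk i) := by
  rw [← T.map_orderEmbOfFin_univ hT, prod_map]
  refine prod_le_prod (fun i _ => hy0 _) fun i _ => hy ?_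
  have : ∀ j (hj : j < k), j ≤ (T.orderEmbOfFin hT ⟨j, hj⟩ : ℕ) := by
    intro j
    induction j with
    | zero => simp
    | succ j ih =>
      intro hj
      have hlt : T.orderEmbOfFin hT ⟨j, by omega⟩ < T.orderEmbOfFin hT ⟨j + 1, hj⟩ :=
        (T.orderEmbOfFin hT).strictMono (by simp [Fin.lt_def])
      have := ih (by omega)
      rw [Fin.lt_def] at hlt
      omega
  exact this i i.2

theorem sum_mul_le_sum_mul_of_prod_le {m : ℕ} {a x y : Fin m → ℝ} (ha : Antitone a)
    (ha0 : ∀ i, 0 ≤ a i) (hx : Antitone x) (hx0 : ∀ i, 0 ≤ x i) (hy : Antitone y)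
    (hy0 : ∀ i, 0 ≤ y i)
    (h : ∀ S : Finset (Fin m), ∃ T : Finset (Fin m), #T = #S ∧ ∏ i ∈ S, x i ≤ ∏ i ∈ T, y i) :
    ∑ i, a i * x i ≤ ∑ i, a i * y i := by
  let ext (z : Fin m → ℝ) (i : ℕ) : ℝ := if hi : i < m then z ⟨i, hi⟩ else 0
  have ext_val (z : Fin m → ℝ) (i : Fin m) : ext z i = z i := by simp [ext]
  have ext_nonneg {z : Fin m → ℝ} (hz : ∀ i, 0 ≤ z i) (i : ℕ) : 0 ≤ ext z i := by
    by_cases hi : i < m <;> simp [ext, hi, hz]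
  have ext_antitone {z : Fin m → ℝ} (hz : Antitone z) (hz0 : ∀ i, 0 ≤ z i) : Antitone (ext z) := by
    intro i j hij
    by_cases hj : j < m
    · have hi : i < m := by omega
      simpa [ext, hi, hj] using hz (by simpa using hij)
    · simpa [ext, hj] using ext_nonneg hz0 i
  have ext_prod (z : Fin m → ℝ) {k : ℕ} (hk : k ≤ m) :
      ∏ i ∈ range k, ext z i = ∏ i : Fin k, z (Fin.castLE hk i) := by
    rw [← Fin.prod_univ_eq_prod_range]
    exact prod_congr rfl fun i _ => ext_val z (Fin.castLE hk i)
  have key := sum_range_mul_le_sum_range_mul_of_prod_range_le (ext_antitone ha ha0)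
    (ext_nonneg ha0) (ext_antitone hx hx0) (ext_nonneg hx0) (ext_nonneg hy0) (m := m) (by
      intro k hk
      obtain ⟨T, hT, hle⟩ := h (univ.map (Fin.castLEEmb hk))
      rw [prod_map] at hle
      rw [ext_prod x hk, ext_prod y hk]
      exact hle.trans (hy.prod_le_prod_castLE hk hy0 (by simpa using hT)))
  rw [← Fin.sum_univ_eq_sum_range (fun i => ext a i * ext x i),
    ← Fin.sum_univ_eq_sum_range (fun i => ext a i * ext y i)] at key
  simpa only [ext_val] using key

theorem exists_equiv_fin_antitone {n : Type*} [Fintype n] (g : n → ℝ) :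
    ∃ e : Fin (Fintype.card n) ≃ n, Antitone (g ∘ e) := by
  let e₀ := (Fintype.equivFin n).symm
  refine ⟨(Tuple.sort fun i => -g (e₀ i)).trans e₀, fun i j hij => ?_⟩
  simpa using Tuple.monotone_sort (fun i => -g (e₀ i)) hij

/-- Otherwise a functional with coefficients `c` strictly separates `x` from the hull. Rearrangement
and log-majorization bound its value at `x` by the sorted pairing of `|c|` with `y`, which is
attained at a signed permutation of `y`. -/
theorem mem_convexHull_signed_perm_of_prod_le {n : Type*} [Fintype n] {x y : n → ℝ} (hx0 : 0 ≤ x)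
    (hy0 : 0 ≤ y) (h : ∀ S : Finset n, ∃ T : Finset n, #T = #S ∧ ∏ i ∈ S, x i ≤ ∏ i ∈ T, y i) :
    x ∈ convexHull ℝ (Set.range fun p : (n → ℤˣ) × Equiv.Perm n =>
      fun i => ((p.1 i : ℤ) : ℝ) * y (p.2 i)) := by
  classical
  by_contra hmem
  obtain ⟨f, u, hfu, hux⟩ := geometric_hahn_banach_closed_point (convex_convexHull ℝ _)
    ((Set.finite_range _).isClosed_convexHull ℝ) hmem
  let c : n → ℝ := fun i => f (Pi.single i 1)
  have hf (z : n → ℝ) : f z = ∑ i, c i * z i := by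
    conv_lhs => rw [← Finset.univ_sum_single z]
    rw [map_sum]
    refine sum_congr rfl fun i _ => ?_
    have : Pi.single i (z i) = z i • (Pi.single i 1 : n → ℝ) := by rw [← Pi.single_smul]; simp
    rw [this, map_smul, smul_eq_mul, mul_comm]
  obtain ⟨ea, ha⟩ := exists_equiv_fin_antitone fun i => |c i|
  obtain ⟨ex, hx⟩ := exists_equiv_fin_antitone x
  obtain ⟨ey, hy⟩ := exists_equiv_fin_antitone y
  have h1 : f x ≤ ∑ i, |c (ea i)| * x (ea i) := by
    rw [hf, Equiv.sum_comp ea fun i => |c i| * x i]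
    exact sum_le_sum fun i _ => mul_le_mul_of_nonneg_right (le_abs_self _) (hx0 i)
  have h2 : ∑ i, |c (ea i)| * x (ea i) ≤ ∑ i, |c (ea i)| * x (ex i) := by
    have := (ha.monovary hx).sum_mul_comp_perm_le_sum_mul (σ := ea.trans ex.symm)
    simpa using this
  have h3 : ∑ i, |c (ea i)| * x (ex i) ≤ ∑ i, |c (ea i)| * y (ey i) := by
    refine sum_mul_le_sum_mul_of_prod_le ha (fun i => abs_nonneg _) hx (fun i => hx0 _) hy
      (fun i => hy0 _) fun S => ?_
    obtain ⟨T, hT, hle⟩ := h (S.map ex.toEmbedding)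
    refine ⟨T.map ey.symm.toEmbedding, by simpa using hT, ?_⟩
    simpa [prod_map] using hle
  let ε : n → ℤˣ := fun i => if 0 ≤ c i then 1 else -1
  have hε (i : n) : c i * ((ε i : ℤ) : ℝ) = |c i| := by
    by_cases hi : 0 ≤ c i
    · simp [ε, hi, abs_of_nonneg hi]
    · simp [ε, hi, abs_of_neg (not_le.1 hi)]
  have h4 := hfu _ (subset_convexHull ℝ _ ⟨(ε, ea.symm.trans ey), rfl⟩)
  have h5 : f (fun i => ((ε i : ℤ) : ℝ) * y ((ea.symm.trans ey) i))
      = ∑ i, |c (ea i)| * y (ey i) := by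
    rw [hf, ← Equiv.sum_comp ea]
    refine sum_congr rfl fun i _ => ?_
    rw [← mul_assoc, hε]
    simp
  simp only at h4
  rw [h5] at h4
  linarith

end Majorization

/-! ### From compound norms to unitarily invariant norms. -/

namespace IsUnitarilyInvariantNorm

open Matrix
open scoped Matrix.Norms.L2Operator

variable {n : Type*} [Fintype n] [DecidableEq n] {N : Seminorm ℂ (Matrix n n ℂ)}

theorem map_unitaryDiagonal (hN : IsUnitarilyInvariantNorm N) (U : unitaryGroup n ℂ) (d : n → ℝ) :
    N (unitaryDiagonal U d) = N (diagonal fun i => (d i : ℂ)) :=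
  hN.map_unitary_mul_mul U U.2 _ (star U).2 _

theorem map_diagonal_signed_perm (hN : IsUnitarilyInvariantNorm N) (ε : n → ℤˣ)
    (σ : Equiv.Perm n) (y : n → ℝ) :
    N (diagonal fun i => ((((ε i : ℤ) : ℝ) * y (σ i) : ℝ) : ℂ)) =
      N (diagonal fun i => (y i : ℂ)) := by
  let P : Matrix n n ℂ := σ.permMatrix ℂ
  have hP : P ∈ unitaryGroup n ℂ := by
    rw [mem_unitaryGroup_iff, star_eq_conjTranspose, conjTranspose_permMatrix, ← permMatrix_mul,
      inv_mul_cancel, permMatrix_one]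
  have hD : diagonal (fun i => ((ε i : ℤ) : ℂ)) ∈ unitaryGroup n ℂ := by
    rw [mem_unitaryGroup_iff, star_eq_conjTranspose, diagonal_conjTranspose, diagonal_mul_diagonal,
      ← diagonal_one]
    congr 1
    ext i
    rcases Int.units_eq_one_or (ε i) with h | h <;> simp [h]
  rw [← hN.map_unitary_mul_mul _ (mul_mem hD hP) _ (Unitary.star_mem hP)
    (diagonal fun i => (y i : ℂ))]
  congr 1
  have h : P * diagonal (fun i => (y i : ℂ)) * star P = diagonal fun i => (y (σ i) : ℂ) := by
    rw [star_eq_conjTranspose, conjTranspose_permMatrix]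
    change σ.toPEquiv.toMatrix * _ * (Equiv.toPEquiv σ⁻¹).toMatrix = _
    rw [PEquiv.toMatrix_toPEquiv_mul, PEquiv.mul_toMatrix_toPEquiv, submatrix_submatrix]
    exact submatrix_diagonal _ _ σ.injective
  rw [mul_assoc, mul_assoc, ← mul_assoc P, h, diagonal_mul_diagonal]
  simp

theorem map_diagonal_le (hN : IsUnitarilyInvariantNorm N) {x y : n → ℝ} (hx : 0 ≤ x) (hy : 0 ≤ y)
    (h : ∀ S : Finset n, ∃ T : Finset n, T.card = S.card ∧ ∏ i ∈ S, x i ≤ ∏ i ∈ T, y i) :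
    N (diagonal fun i => (x i : ℂ)) ≤ N (diagonal fun i => (y i : ℂ)) := by
  let φ : (n → ℝ) →ₗ[ℝ] Matrix n n ℂ := (unitaryDiagonal 1).toLinearMap
  have hφ (z : n → ℝ) : φ z = diagonal fun i => (z i : ℂ) := by
    simp [φ, unitaryDiagonal_apply]
  have hconv : Convex ℝ {z | N (φ z) ≤ N (φ y)} := by
    have := (((N.restrictScalars ℝ).comp φ).convexOn.convex_le (N (φ y)))
    simpa using this
  have := convexHull_min (t := {z | N (φ z) ≤ N (φ y)}) (by
    rintro _ ⟨⟨ε, σ⟩, rfl⟩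
    simp only [Set.mem_ofPred_eq, hφ]
    exact (hN.map_diagonal_signed_perm ε σ y).le) hconv
    (mem_convexHull_signed_perm_of_prod_le hx hy h)
  simpa only [Set.mem_ofPred_eq, hφ] using this

theorem map_le_of_norm_compound_le {n : Type*} [Fintype n] [LinearOrder n]
    {N : Seminorm ℂ (Matrix n n ℂ)} (hN : IsUnitarilyInvariantNorm N) {X Y : Matrix n n ℂ}
    (hX : X.PosSemidef) (hY : Y.PosSemidef) (h : ∀ k, ‖compound k X‖ ≤ ‖compound k Y‖) :
    N X ≤ N Y := by
  obtain ⟨U, x, hx, rfl⟩ := hX.exists_eq_unitaryDiagonal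
  obtain ⟨V, y, hy, rfl⟩ := hY.exists_eq_unitaryDiagonal
  rw [hN.map_unitaryDiagonal, hN.map_unitaryDiagonal]
  refine hN.map_diagonal_le hx hy fun S => ?_
  let S' : Set.powersetCard n S.card := ⟨S, rfl⟩
  have hS : ∏ i ∈ S, x i ≤ ‖compound S.card (unitaryDiagonal U x)‖ := by
    rw [norm_compound_unitaryDiagonal]
    exact (le_abs_self _).trans
      (norm_le_pi_norm (fun s : Set.powersetCard n S.card => ∏ i ∈ s.1, x i) S')
  have : Nonempty (Set.powersetCard n S.card) := ⟨S'⟩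
  obtain ⟨T, hT⟩ := Finite.exists_max fun s : Set.powersetCard n S.card => ∏ i ∈ s.1, y i
  refine ⟨T.1, T.2, (hS.trans (h _)).trans ?_⟩
  rw [norm_compound_unitaryDiagonal]
  refine (pi_norm_le_iff_of_nonempty _).2 fun s => ?_
  rw [Real.norm_of_nonneg (Finset.prod_nonneg fun i _ => hy i)]
  exact hT s

end IsUnitarilyInvariantNorm

theorem proposition2 {n : Type*} [Fintype n] [DecidableEq n]
    (N : Seminorm ℂ (Matrix n n ℂ)) (hN : IsUnitarilyInvariantNorm N)
    (A B : Matrix n n ℂ) (hB : B.PosSemidef) (q : ℝ) (hq : 1 ≤ q) :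
    N ((A * B * Aᴴ) ^ q) ≤ N (CFC.abs A ^ q * B ^ q * CFC.abs A ^ q) := by
  -- An arbitrary order on the indices, needed only to define compounds.
  let o : LinearOrder n := LinearOrder.lift' (Fintype.equivFin n) (Fintype.equivFin n).injective
  obtain rfl : ‹DecidableEq n› = o.toDecidableEq := Subsingleton.elim _ _
  have hPq : (CFC.abs A ^ q).IsHermitian :=
    (Matrix.nonneg_iff_posSemidef.1 CFC.rpow_nonneg).isHermitian
  have hY : (CFC.abs A ^ q * B ^ q * CFC.abs A ^ q).PosSemidef := by
    have hBq : (B ^ q).PosSemidef := Matrix.nonneg_iff_posSemidef.1 CFC.rpow_nonneg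
    have := hBq.mul_mul_conjTranspose_same (CFC.abs A ^ q)
    rwa [hPq.eq] at this
  exact hN.map_le_of_norm_compound_le (Matrix.nonneg_iff_posSemidef.1 CFC.rpow_nonneg) hY
    fun k => Matrix.norm_compound_mul_mul_conjTranspose_rpow_le k A hB hq
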